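/- Let $B_m$ denote the Bernoulli numbers, defined by $\frac{t}{e^t-1}=\sum_{m\ge 0}B_m\frac{t^m}{m!}$, and for a sequence $(c_k)_{k\ge 0}$ let $H_n(c_k)=\det\big(c_{i+j}\big)_{0\le i,j\le n}$ be its $n$th Hankel determinant, of order $n+1$. Then for all integers $n\ge 0$, $$H_n\big((2k+3)B_{2k+2}\big)=\frac{1}{2^{n+1}}\prod_{\ell=1}^{n}\left(\frac{\ell^{3}(\ell+1)^{3}}{4(2\ell+1)^{2}}\right)^{n+1-\ell},$$ where for $n=0$ the empty product equals $1$. -/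

import Mathlib

/-- The Hankel matrix `(c (i + j))` with `0 ≤ i, j ≤ n`, of size `n + 1`. -/
def hankelMatrix {R : Type*} (c : ℕ → R) (n : ℕ) : Matrix (Fin (n + 1)) (Fin (n + 1)) R :=
  Matrix.of fun i j => c ((i : ℕ) + (j : ℕ))

/-- The `n`th Hankel determinant `H_n(c)` of the sequence `c 0, c 1, …`. -/
def hankelDet {R : Type*} [CommRing R] (c : ℕ → R) (n : ℕ) : R :=
  (hankelMatrix c n).det

/-! The moments come from L(p) = B((x³ p(x²))'), where B sends x^m to B_m. The Bernoulli recurrence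
says B(p(x+1)) - B(p(x)) = p'(0), so L(p) = g''(0) for any g whose forward difference is x³ p(x²).
For q_j = ∏_{i=1}^{j} (X - i²), the polynomial x q_j(x²) is a central factorial with an explicit
antidifference. Hence L(q_i q_j) = d_i d_j / (i + j + 2) with d_j = (-1)^j j! (j+1)!. Passing to the
monic basis q_j turns the Hankel determinant into a diagonally scaled Cauchy determinant, evaluated
by Schur complements. -/

section

open Polynomial hiding bernoulli sum_bernoulli

/-- The umbral functional on polynomials that sends `X ^ m` to the Bernoulli number `B_m`. -/
noncomputable def bernoulliFunctional : ℚ[X] →ₗ[ℚ] ℚ :=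
  Polynomial.lsum fun k => bernoulli k • LinearMap.id

/-- The functional on polynomials that sends `X ^ k` to `(2 k + 3) B_{2 k + 2}`. -/
noncomputable def evenBernoulliFunctional : ℚ[X] →ₗ[ℚ] ℚ :=
  Polynomial.lsum fun k => ((2 * (k : ℚ) + 3) * bernoulli (2 * k + 2)) • LinearMap.id

/-- The monic polynomial `∏ (X - i ^ 2)` with `1 ≤ i ≤ j`. -/
noncomputable def squareRootsPoly (j : ℕ) : ℚ[X] :=
  ∏ i ∈ Finset.range j, (X - C (((i : ℚ) + 1) ^ 2))

theorem bernoulliFunctional_C_mul_X_pow (a : ℚ) (n : ℕ) :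
    bernoulliFunctional (C a * X ^ n) = a * bernoulli n := by
  rw [C_mul_X_pow_eq_monomial, bernoulliFunctional, Polynomial.lsum_apply,
    Polynomial.sum_monomial_index _ _ (by simp)]
  simp [mul_comm]

theorem evenBernoulliFunctional_C_mul_X_pow (a : ℚ) (n : ℕ) :
    evenBernoulliFunctional (C a * X ^ n) = a * ((2 * (n : ℚ) + 3) * bernoulli (2 * n + 2)) := by
  rw [C_mul_X_pow_eq_monomial, evenBernoulliFunctional, Polynomial.lsum_apply,
    Polynomial.sum_monomial_index _ _ (by simp)]
  simp [mul_comm]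

theorem bernoulliFunctional_comp_X_add_one (p : ℚ[X]) :
    bernoulliFunctional (p.comp (X + 1)) = bernoulliFunctional p + (derivative p).eval 0 := by
  induction p using Polynomial.induction_on' with
  | add p q hp hq =>
    simp only [add_comp, map_add, hp, hq, eval_add]; ring
  | monomial n a =>
    have key : bernoulliFunctional (C a * (X + 1) ^ n)
        = a * ∑ k ∈ Finset.range (n + 1), (n.choose k : ℚ) * bernoulli k := by
      rw [add_pow, Finset.mul_sum, map_sum, Finset.mul_sum]
      refine Finset.sum_congr rfl fun k _ => ?_
      rw [← mul_assoc a, ← bernoulliFunctional_C_mul_X_pow, C_mul]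
      congr 1
      simp only [one_pow, mul_one, map_natCast]
      ring
    rw [← C_mul_X_pow_eq_monomial, mul_comp, C_comp, X_pow_comp, key,
      bernoulliFunctional_C_mul_X_pow, Finset.sum_range_succ, sum_bernoulli, derivative_C_mul_X_pow]
    -- The recurrence sum and the derivative of X^n at 0 both equal 1 for n = 1 and vanish
    -- otherwise.
    rcases n with _ | _ | n
    · simp
    · simp; ring
    · simp

theorem bernoulliFunctional_derivative_of_difference {f g : ℚ[X]} (h : g.comp (X + 1) - g = f) :
    bernoulliFunctional (derivative f) = (derivative (derivative g)).eval 0 := by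
  have h1 : derivative f = (derivative g).comp (X + 1) - derivative g := by
    rw [← h, derivative_sub, derivative_comp]; simp
  rw [h1, map_sub, bernoulliFunctional_comp_X_add_one]
  ring

theorem evenBernoulliFunctional_eq (p : ℚ[X]) :
    evenBernoulliFunctional p =
      bernoulliFunctional (derivative (X ^ 3 * p.comp (X ^ 2))) := by
  induction p using Polynomial.induction_on' with
  | add p q hp hq => simp only [add_comp, mul_add, map_add, hp, hq]
  | monomial n a =>
    have h : (X : ℚ[X]) ^ 3 * (C a * (X ^ 2) ^ n) = C a * X ^ (2 * n + 3) := by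
      ring
    rw [← C_mul_X_pow_eq_monomial, mul_comp, C_comp, X_pow_comp, h,
      evenBernoulliFunctional_C_mul_X_pow, derivative_C_mul_X_pow,
      bernoulliFunctional_C_mul_X_pow]
    rw [show 2 * n + 3 - 1 = 2 * n + 2 from rfl]
    push_cast
    ring

theorem squareRootsPoly_succ (j : ℕ) :
    squareRootsPoly (j + 1) = squareRootsPoly j * (X - C (((j : ℚ) + 1) ^ 2)) :=
  Finset.prod_range_succ _ _

theorem squareRootsPoly_monic (j : ℕ) : (squareRootsPoly j).Monic :=
  monic_prod_of_monic _ _ fun _ _ => monic_X_sub_C _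

theorem squareRootsPoly_natDegree (j : ℕ) : (squareRootsPoly j).natDegree = j := by
  rw [squareRootsPoly, natDegree_prod_of_monic _ _ fun _ _ => monic_X_sub_C _]
  simp only [natDegree_X_sub_C]
  simp

theorem squareRootsPoly_eval_zero (j : ℕ) :
    (squareRootsPoly j).eval 0 = (-1) ^ j * (j.factorial : ℚ) ^ 2 := by
  induction j with
  | zero => simp [squareRootsPoly]
  | succ j ih =>
    rw [squareRootsPoly_succ, eval_mul, ih, Nat.factorial_succ]
    simp only [eval_sub, eval_X, eval_C]
    push_cast
    ring

/-- Since x q_j(x²) = ∏_{|i| ≤ j} (x + i), the shift x ↦ x + 1 loses the factor x - j and gains x +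
j + 1. -/
theorem X_mul_squareRootsPoly_comp_shift (j : ℕ) :
    (X - C (j : ℚ)) * (X * (squareRootsPoly j).comp (X ^ 2)).comp (X + 1) =
      (X + C ((j : ℚ) + 1)) * (X * (squareRootsPoly j).comp (X ^ 2)) := by
  induction j with
  | zero => simp [squareRootsPoly]; ring
  | succ j ih =>
    rw [squareRootsPoly_succ]
    simp only [mul_comp, sub_comp, X_comp, C_comp, X_pow_comp] at ih ⊢
    simp only [C_pow, C_add, C_1, Nat.cast_add, Nat.cast_one] at ih ⊢
    linear_combination (X - (C (j : ℚ) + 1)) * (X + (C (j : ℚ) + 1) + 1) * ih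

theorem squareRootsPoly_difference (j : ℕ) :
    ((X - C ((j : ℚ) + 1)) * (X * (squareRootsPoly j).comp (X ^ 2))).comp (X + 1) -
      (X - C ((j : ℚ) + 1)) * (X * (squareRootsPoly j).comp (X ^ 2)) =
      C (2 * (j : ℚ) + 2) * (X * (squareRootsPoly j).comp (X ^ 2)) := by
  have h := X_mul_squareRootsPoly_comp_shift j
  rw [mul_comp]
  generalize (X * (squareRootsPoly j).comp (X ^ 2)).comp (X + 1) = u at *
  simp only [sub_comp, X_comp, C_comp]
  simp only [C_add, C_mul, C_1, show (C (2 : ℚ)) = 2 from rfl] at h ⊢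
  linear_combination h

theorem second_derivative_X_sub_C_mul_even (c : ℚ) (s : ℚ[X]) :
    (derivative (derivative ((X - C c) * (X * s.comp (X ^ 2))))).eval 0 = 2 * s.eval 0 := by
  simp [derivative_mul, derivative_comp, eval_comp]
  ring

theorem evenBernoulliFunctional_squareRootsPoly (j : ℕ) :
    evenBernoulliFunctional (squareRootsPoly j) =
      (-1) ^ j * (j.factorial : ℚ) * ((j + 1).factorial : ℚ) / ((j : ℚ) + 2) := by
  have h0 := squareRootsPoly_difference j
  have h1 := squareRootsPoly_difference (j + 1)
  have hj1 : (2 * (j : ℚ) + 2) ≠ 0 := by positivity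
  have hj2 : (2 * ((j + 1 : ℕ) : ℚ) + 2) ≠ 0 := by positivity
  have e1 : C (2 * ((j + 1 : ℕ) : ℚ) + 2)⁻¹ * C (2 * ((j + 1 : ℕ) : ℚ) + 2) = 1 := by
    rw [← C_mul, inv_mul_cancel₀ hj2, C_1]
  have e0 : C (((j : ℚ) + 1) ^ 2 / (2 * (j : ℚ) + 2)) * C (2 * (j : ℚ) + 2)
      = C (((j : ℚ) + 1) ^ 2) := by
    rw [← C_mul, div_mul_cancel₀ _ hj1]
  have hs : X * (squareRootsPoly (j + 1)).comp (X ^ 2) =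
      (X * (squareRootsPoly j).comp (X ^ 2)) * (X ^ 2 - C (((j : ℚ) + 1) ^ 2)) := by
    rw [squareRootsPoly_succ]
    simp only [mul_comp, sub_comp, X_comp, C_comp]
    ring
  -- The antidifference comes from x³ q_j(x²) = x q_{j+1}(x²) + (j+1)² x q_j(x²), each term being
  -- summed by `squareRootsPoly_difference`.
  have hd : (C (2 * ((j + 1 : ℕ) : ℚ) + 2)⁻¹ *
        ((X - C (((j + 1 : ℕ) : ℚ) + 1)) * (X * (squareRootsPoly (j + 1)).comp (X ^ 2))) +
      C (((j : ℚ) + 1) ^ 2 / (2 * (j : ℚ) + 2)) *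
        ((X - C ((j : ℚ) + 1)) * (X * (squareRootsPoly j).comp (X ^ 2)))).comp (X + 1) -
      (C (2 * ((j + 1 : ℕ) : ℚ) + 2)⁻¹ *
        ((X - C (((j + 1 : ℕ) : ℚ) + 1)) * (X * (squareRootsPoly (j + 1)).comp (X ^ 2))) +
      C (((j : ℚ) + 1) ^ 2 / (2 * (j : ℚ) + 2)) *
        ((X - C ((j : ℚ) + 1)) * (X * (squareRootsPoly j).comp (X ^ 2)))) =
      X ^ 3 * (squareRootsPoly j).comp (X ^ 2) := by
    rw [add_comp, mul_comp (C _), mul_comp (C _), C_comp, C_comp]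
    generalize ((X - C (((j + 1 : ℕ) : ℚ) + 1)) *
      (X * (squareRootsPoly (j + 1)).comp (X ^ 2))).comp (X + 1) = u1 at *
    generalize ((X - C ((j : ℚ) + 1)) * (X * (squareRootsPoly j).comp (X ^ 2))).comp (X + 1)
      = u0 at *
    linear_combination C (2 * ((j + 1 : ℕ) : ℚ) + 2)⁻¹ * h1 +
      C (((j : ℚ) + 1) ^ 2 / (2 * (j : ℚ) + 2)) * h0 +
      (X * (squareRootsPoly (j + 1)).comp (X ^ 2)) * e1 +
      (X * (squareRootsPoly j).comp (X ^ 2)) * e0 + hs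
  rw [evenBernoulliFunctional_eq, bernoulliFunctional_derivative_of_difference hd]
  simp only [derivative_add, derivative_C_mul, eval_add, eval_C_mul,
    second_derivative_X_sub_C_mul_even, squareRootsPoly_eval_zero, Nat.factorial_succ]
  push_cast
  field_simp
  ring

theorem evenBernoulliFunctional_squareRootsPoly_mul (i j : ℕ) :
    evenBernoulliFunctional (squareRootsPoly i * squareRootsPoly j) =
      ((-1) ^ i * (i.factorial : ℚ) * ((i + 1).factorial : ℚ)) *
        (((-1) ^ j * (j.factorial : ℚ) * ((j + 1).factorial : ℚ)) * (1 / ((i : ℚ) + j + 2))) := by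
  induction i generalizing j with
  | zero =>
    have h : squareRootsPoly 0 = 1 := by simp [squareRootsPoly]
    rw [h, one_mul, evenBernoulliFunctional_squareRootsPoly]
    simp
    ring
  | succ i ih =>
    -- Trading a factor between the two polynomials lowers i, at the cost of raising j; hence j is
    -- generalized.
    have h : squareRootsPoly (i + 1) * squareRootsPoly j =
        squareRootsPoly i * squareRootsPoly (j + 1) +
          (((j : ℚ) + 1) ^ 2 - ((i : ℚ) + 1) ^ 2) • (squareRootsPoly i * squareRootsPoly j) := by
      rw [squareRootsPoly_succ, squareRootsPoly_succ, smul_eq_C_mul, C_sub]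
      ring
    rw [h, map_add, map_smul, ih, ih, smul_eq_mul]
    have h2 : (i : ℚ) + j + 2 ≠ 0 := by positivity
    have h3 : (i : ℚ) + j + 3 ≠ 0 := by positivity
    simp only [Nat.factorial_succ]
    push_cast
    rw [show (i : ℚ) + (j + 1) + 2 = i + j + 3 by ring,
      show (i : ℚ) + 1 + j + 2 = i + j + 3 by ring]
    field_simp
    ring

/-- A change of basis to monic polynomials does not change the Hankel determinant of the moments
of a functional. -/
theorem det_functional_mul_eq_hankelDet {R : Type*} [CommRing R] (L : R[X] →ₗ[R] R) (p : ℕ → R[X])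
    (hdeg : ∀ i, (p i).natDegree = i) (hmonic : ∀ i, (p i).Monic) (n : ℕ) :
    (Matrix.of fun i j : Fin (n + 1) => L (p i * p j)).det =
      hankelDet (fun k => L (X ^ k)) n := by
  set T : Matrix (Fin (n + 1)) (Fin (n + 1)) R := Matrix.of fun i j => (p j).coeff i with hT
  have hdet : T.det = 1 :=
    Matrix.det_matrixOfPolynomials (fun i : Fin (n + 1) => p i) (fun i => hdeg i)
      fun i => hmonic i
  have hp : ∀ i : Fin (n + 1), p i = ∑ k : Fin (n + 1), (p i).coeff k • (X : R[X]) ^ (k : ℕ) := by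
    intro i
    conv_lhs => rw [(p i).as_sum_range' (n + 1) (by rw [hdeg]; exact i.2)]
    rw [Finset.sum_range]
    simp only [smul_X_eq_monomial]
  have hmul : (Matrix.of fun i j : Fin (n + 1) => L (p i * p j)) =
      T.transpose * hankelMatrix (fun k => L (X ^ k)) n * T := by
    ext i j
    rw [Matrix.of_apply, hp i, hp j, Finset.sum_mul_sum, Finset.sum_comm]
    simp only [map_sum, smul_mul_smul_comm, ← pow_add, map_smul, smul_eq_mul]
    simp only [Matrix.mul_apply, hankelMatrix, Matrix.of_apply, Matrix.transpose_apply, hT,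
      Finset.sum_mul]
    refine Finset.sum_congr rfl fun a _ => Finset.sum_congr rfl fun b _ => ?_
    ring
  rw [hmul, Matrix.det_mul, Matrix.det_mul, Matrix.det_transpose, hdet, hankelDet, one_mul, mul_one]

/-- Elimination of the last row and column of a Cauchy matrix. -/
theorem det_cauchy_succ {K : Type*} [Field K] (x y : ℕ → K) (n : ℕ)
    (h : ∀ i j, x i + y j ≠ 0) :
    (Matrix.of fun i j : Fin (n + 1) => 1 / (x i + y j)).det =
      1 / (x n + y n) * ((∏ i ∈ Finset.range n, (x n - x i) / (x i + y n)) *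
        ((∏ j ∈ Finset.range n, (y n - y j) / (x n + y j)) *
          (Matrix.of fun i j : Fin n => 1 / (x i + y j)).det)) := by
  have hb : (Matrix.of fun i j : Fin (n + 1) => 1 / (x i + y j)).submatrix
      (finSumFinEquiv (m := n) (n := 1)) (finSumFinEquiv (m := n) (n := 1)) =
      Matrix.fromBlocks (Matrix.of fun i j : Fin n => 1 / (x i + y j))
        (Matrix.of fun (i : Fin n) (_ : Fin 1) => 1 / (x i + y n))
        (Matrix.of fun (_ : Fin 1) (j : Fin n) => 1 / (x n + y j))
        (Matrix.diagonal fun _ : Fin 1 => 1 / (x n + y n)) := by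
    ext i j
    rcases i with i | i <;> rcases j with j | j <;>
      simp [Subsingleton.elim _ (0 : Fin 1)]
  rw [← Matrix.det_submatrix_equiv_self (finSumFinEquiv (m := n) (n := 1)), hb]
  let : Invertible (fun _ : Fin 1 => 1 / (x n + y n)) :=
    ⟨fun _ => x n + y n, by ext; simp [h], by ext; simp [h]⟩
  let : Invertible (Matrix.diagonal fun _ : Fin 1 => 1 / (x n + y n)) :=
    Matrix.diagonalInvertible _
  rw [Matrix.det_fromBlocks₂₂, Matrix.det_diagonal, Finset.prod_range, Finset.prod_range,
    ← Matrix.det_mul_row, ← Matrix.det_mul_column]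
  simp only [Finset.univ_unique, Finset.prod_const, Finset.card_singleton, pow_one]
  -- The Schur complement has entries (x_n - x_i)(y_n - y_j) / ((x_i + y_j)(x_i + y_n)(x_n + y_j)):
  -- the smaller Cauchy matrix with scaled rows and columns.
  congr 2
  ext i j
  have hi : (⅟(Matrix.diagonal fun _ : Fin 1 => 1 / (x n + y n))) =
      Matrix.diagonal fun _ : Fin 1 => x n + y n := rfl
  have h1 := h i j
  have h2 := h n j
  have h3 := h i n
  rw [hi]
  simp [Matrix.mul_apply, Matrix.diagonal]
  field_simp
  ring

theorem prod_range_sub_div_add (n : ℕ) :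
    ∏ i ∈ Finset.range n, (((n : ℚ) + 1) - ((i : ℚ) + 1)) / (((i : ℚ) + 1) + ((n : ℚ) + 1)) =
      (n.factorial : ℚ) * ((n + 1).factorial : ℚ) / ((2 * n + 1).factorial : ℚ) := by
  have h1 : ∏ i ∈ Finset.range n, (((n : ℚ) + 1) - ((i : ℚ) + 1)) = n.factorial := by
    rw [← Finset.prod_range_add_one_eq_factorial, ← Finset.prod_range_reflect (fun i => i + 1)]
    push_cast
    refine Finset.prod_congr rfl fun i hi => ?_
    have : i + 1 ≤ n := Finset.mem_range.mp hi
    rw [Nat.sub_sub, Nat.cast_sub (by omega)]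
    push_cast
    ring
  have h2 : ((n + 1).factorial : ℚ) *
      ∏ i ∈ Finset.range n, (((i : ℚ) + 1) + ((n : ℚ) + 1)) = (2 * n + 1).factorial := by
    rw [show 2 * n + 1 = n + 1 + n by ring, ← Nat.factorial_mul_ascFactorial (n + 1) n,
      Nat.ascFactorial_eq_prod_range _ n]
    push_cast
    refine congrArg _ (Finset.prod_congr rfl fun i _ => ?_)
    ring
  have h3 : ((n + 1).factorial : ℚ) ≠ 0 := by positivity
  rw [Finset.prod_div_distrib, h1, ← h2, mul_comm (n.factorial : ℚ), mul_div_mul_left _ _ h3]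

theorem det_inv_add_add_two_succ (n : ℕ) :
    (Matrix.of fun i j : Fin (n + 1) => 1 / ((i : ℚ) + (j : ℚ) + 2)).det =
      ((n.factorial : ℚ) * ((n + 1).factorial : ℚ) / ((2 * n + 1).factorial : ℚ)) ^ 2 /
        (2 * (n : ℚ) + 2) *
        (Matrix.of fun i j : Fin n => 1 / ((i : ℚ) + (j : ℚ) + 2)).det := by
  have h := det_cauchy_succ (fun i => (i : ℚ) + 1) (fun i => (i : ℚ) + 1) n
    fun i j => by positivity
  have e : ∀ a b : ℚ, a + 1 + (b + 1) = a + b + 2 := fun a b => by ring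
  have h' := prod_range_sub_div_add n
  have h'' := h'
  simp only [add_comm (_ + 1 : ℚ) ((n : ℚ) + 1)] at h''
  rw [h', h''] at h
  simp only [e] at h
  rw [h]
  ring

theorem hankelDet_evenBernoulli_eq (n : ℕ) :
    hankelDet (fun k : ℕ => (2 * (k : ℚ) + 3) * bernoulli (2 * k + 2)) n =
      (∏ i ∈ Finset.range (n + 1), ((i.factorial : ℚ) * ((i + 1).factorial : ℚ)) ^ 2) *
        (Matrix.of fun i j : Fin (n + 1) => 1 / ((i : ℚ) + (j : ℚ) + 2)).det := by
  have hL : (fun k : ℕ => (2 * (k : ℚ) + 3) * bernoulli (2 * k + 2)) =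
      fun k => evenBernoulliFunctional (X ^ k) := by
    ext k
    simpa using (evenBernoulliFunctional_C_mul_X_pow 1 k).symm
  rw [hL, ← det_functional_mul_eq_hankelDet _ _ squareRootsPoly_natDegree squareRootsPoly_monic]
  simp only [evenBernoulliFunctional_squareRootsPoly_mul]
  have h := Matrix.det_mul_column
    (fun i : Fin (n + 1) => (-1) ^ (i : ℕ) * ((i : ℕ).factorial : ℚ) * (((i : ℕ) + 1).factorial : ℚ))
    (Matrix.of fun i j : Fin (n + 1) => ((-1) ^ (j : ℕ) * ((j : ℕ).factorial : ℚ) *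
      (((j : ℕ) + 1).factorial : ℚ)) * (1 / ((i : ℚ) + (j : ℚ) + 2)))
  have h' := Matrix.det_mul_row
    (fun i : Fin (n + 1) => (-1) ^ (i : ℕ) * ((i : ℕ).factorial : ℚ) * (((i : ℕ) + 1).factorial : ℚ))
    (Matrix.of fun i j : Fin (n + 1) => (1 / ((i : ℚ) + (j : ℚ) + 2)))
  simp only [Matrix.of_apply] at h h'
  rw [h, h', Finset.prod_range, ← mul_assoc, ← Finset.prod_mul_distrib]
  congr 1
  refine Finset.prod_congr rfl fun i _ => ?_
  have : ((-1 : ℚ) ^ (i : ℕ)) ^ 2 = 1 := by rw [← pow_mul, mul_comm, pow_mul]; simp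
  linear_combination (((i : ℕ).factorial : ℚ) * (((i : ℕ) + 1).factorial : ℚ)) ^ 2 * this

/-- The right side is the ratio of the Hankel determinants of orders n + 1 and n, which drives the
final induction. -/
theorem half_mul_prod_Icc_eq_factorial (n : ℕ) :
    1 / 2 * ∏ l ∈ Finset.Icc 1 n,
        ((l : ℚ) ^ 3 * ((l : ℚ) + 1) ^ 3 / (4 * (2 * (l : ℚ) + 1) ^ 2)) =
      ((n.factorial : ℚ) * ((n + 1).factorial : ℚ)) ^ 2 *
        (((n.factorial : ℚ) * ((n + 1).factorial : ℚ) / ((2 * n + 1).factorial : ℚ)) ^ 2 /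
        (2 * (n : ℚ) + 2)) := by
  induction n with
  | zero => simp
  | succ n ih =>
    rw [Finset.prod_Icc_succ_top (by omega), ← mul_assoc, ih]
    rw [show 2 * (n + 1) + 1 = 2 * n + 1 + 1 + 1 by ring]
    simp only [Nat.factorial_succ (2 * n + 1 + 1), Nat.factorial_succ (2 * n + 1),
      Nat.factorial_succ (n + 1), Nat.factorial_succ n]
    have h1 : ((2 * n + 1).factorial : ℚ) ≠ 0 := by positivity
    push_cast
    field_simp
    ring

theorem prod_Icc_pow_succ {M : Type*} [CommMonoid M] (b : ℕ → M) (n : ℕ) :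
    ∏ l ∈ Finset.Icc 1 (n + 1), b l ^ (n + 1 + 1 - l) =
      (∏ l ∈ Finset.Icc 1 n, b l ^ (n + 1 - l)) * ∏ l ∈ Finset.Icc 1 (n + 1), b l := by
  rw [Finset.prod_Icc_succ_top (by omega), Finset.prod_Icc_succ_top (by omega), ← mul_assoc,
    ← Finset.prod_mul_distrib]
  congr 1
  · refine Finset.prod_congr rfl fun l hl => ?_
    have := (Finset.mem_Icc.mp hl).2
    rw [← pow_succ]
    congr 1
    omega
  · simp

end

theorem corollary6p3 (n : ℕ) :
    hankelDet (fun k : ℕ => (2 * (k : ℚ) + 3) * bernoulli (2 * k + 2)) n =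
      1 / (2 : ℚ) ^ (n + 1) *
        ∏ l ∈ Finset.Icc 1 n,
          ((l : ℚ) ^ 3 * ((l : ℚ) + 1) ^ 3 / (4 * (2 * (l : ℚ) + 1) ^ 2)) ^ (n + 1 - l) := by
  rw [hankelDet_evenBernoulli_eq]
  induction n with
  | zero => simp
  | succ n ih =>
    rw [Finset.prod_range_succ, det_inv_add_add_two_succ, prod_Icc_pow_succ]
    have h := half_mul_prod_Icc_eq_factorial (n + 1)
    generalize ((n + 1).factorial * (n + 1 + 1).factorial : ℚ) ^ 2 = F at *
    generalize _ / (2 * ((n + 1 : ℕ) : ℚ) + 2) = G at *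
    linear_combination (F * G) * ih - (1 / (2 : ℚ) ^ (n + 1) * ∏ l ∈ Finset.Icc 1 n,
      ((l : ℚ) ^ 3 * ((l : ℚ) + 1) ^ 3 / (4 * (2 * (l : ℚ) + 1) ^ 2)) ^ (n + 1 - l)) * h
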